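/- **Theorem (Lipschitz Implicit Function Theorem).** Let $m,k\ge 0$ be integers, let $\Omega\subset\mathbb{R}^m\times\mathbb{R}^k$ be a neighbourhood of a point $(x_0,y_0)$, let $f$ be an $\mathbb{R}^k$-valued function that is Lipschitz on $\Omega$, and put $z_0=f(x_0,y_0)$. Let $\partial f(x_0,y_0)$ denote Clarke's generalized Jacobian, i.e. the convex hull of the set of all limits $\lim_{\nu\to\infty} Df(p_\nu)$, where $(p_\nu)$ runs over the sequences of points of differentiability of $f$ with $p_\nu\to(x_0,y_0)$ for which the limit exists. Assume that every linear map $\ell\in\partial f(x_0,y_0)$ satisfies $$\operatorname{Ker}\ell\cap(\{0\}^m\times\mathbb{R}^k)=\{0\}.$$ Then there are open neighbourhoods $U\subset\mathbb{R}^m$ of $x_0$ and $V\subset\mathbb{R}^k$ of $y_0$ with $U\times V\subset\Omega$, and a unique Lipschitz function $g\colon U\to V$ with $g(x_0)=y_0$, such that $$f^{-1}(z_0)\cap(U\times V)=\{(x,g(x)) : x\in U\}.$$ -/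

import Mathlib

open Set Filter Topology
open scoped NNReal

/-- The set of all limits `lim Df(u n)` along sequences `u n → p` of points at which `f` is
differentiable. -/
def limitingJacobians {E F : Type*} [NormedAddCommGroup E] [NormedSpace ℝ E]
    [NormedAddCommGroup F] [NormedSpace ℝ F] (f : E → F) (p : E) : Set (E →L[ℝ] F) :=
  {L | ∃ u : ℕ → E, (∀ n, DifferentiableAt ℝ f (u n)) ∧ Tendsto u atTop (𝓝 p) ∧
    Tendsto (fun n => fderiv ℝ f (u n)) atTop (𝓝 L)}

/-- Clarke's generalized Jacobian `∂f(p)`: the convex hull of all limits of derivatives of `f`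
at points of differentiability converging to `p`. -/
def clarkeJacobian {E F : Type*} [NormedAddCommGroup E] [NormedSpace ℝ E]
    [NormedAddCommGroup F] [NormedSpace ℝ F] (f : E → F) (p : E) : Set (E →L[ℝ] F) :=
  convexHull ℝ (limitingJacobians f p)

/-! The generalized Jacobian is compact and its elements are injective on the second factor, so a
closed thickening `C` of it is compact, convex and satisfies `c‖v‖ ≤ ‖A (0, v)‖` for one `c > 0`.
Near the base point every derivative of `f` lies in `C`. Averaging `f` over small balls gives a
differentiable `g` uniformly close to `f`, whose derivatives, as averages of elements of `C`, stay
in `C`. The mean value inclusion bounds increments of `g` in `y` below by `c`, and minimizing `‖g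
(x, ·) - z‖` solves the equation for `g`. Both facts pass to `f` as the averaging radius tends to 0.
The lower bound gives uniqueness and, with the Lipschitz bound in `x`, the Lipschitz dependence of
the solution. -/

/-- In a finite-dimensional real space the convex hull of a compact set is compact
(a consequence of Carathéodory's theorem). -/
theorem IsCompact.convexHull_of_finiteDimensional {E : Type*} [NormedAddCommGroup E]
    [NormedSpace ℝ E] [FiniteDimensional ℝ E] {s : Set E} (hs : IsCompact s) :
    IsCompact (convexHull ℝ s) := by
  -- Carathéodory: at most `finrank + 1` points suffice, so the hull is a finite union of continuous
  -- images of compact sets.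
  have key : convexHull ℝ s = ⋃ N ∈ Finset.range (Module.finrank ℝ E + 2),
      (fun q : (Fin N → ℝ) × (Fin N → E) => ∑ i, q.1 i • q.2 i) ''
        (stdSimplex ℝ (Fin N) ×ˢ Set.pi univ fun _ => s) := by
    apply Subset.antisymm
    · intro x hx
      obtain ⟨ι, _, z, w, hz, hind, hw, hw1, hx⟩ := eq_pos_convex_span_of_mem_convexHull hx
      have hcard : Fintype.card ι ≤ Module.finrank ℝ E + 1 :=
        hind.card_le_finrank_succ.trans (Nat.succ_le_succ (Submodule.finrank_le _))
      let e := (Fintype.equivFin ι).symm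
      refine mem_biUnion (x := Fintype.card ι) (by simp; omega)
        ⟨(w ∘ e, z ∘ e), ⟨⟨fun i => (hw _).le, ?_⟩, fun i _ => hz ⟨_, rfl⟩⟩, ?_⟩
      · rw [← hw1]; exact e.sum_comp w
      · rw [← hx]; exact e.sum_comp fun i => w i • z i
    · refine iUnion₂_subset fun N _ => ?_
      rintro _ ⟨⟨w, z⟩, ⟨⟨hw, hw1⟩, hz⟩, rfl⟩
      exact (convex_convexHull ℝ s).sum_mem (fun i _ => hw i) hw1
        fun i _ => subset_convexHull ℝ s (hz i (mem_univ i))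
  rw [key]
  refine (Finset.range _).isCompact_biUnion fun N _ => ?_
  refine ((isCompact_stdSimplex ℝ (Fin N)).prod (isCompact_univ_pi fun _ => hs)).image ?_
  fun_prop

/-! ### Compactness and upper semicontinuity of the generalized Jacobian -/

section Jacobian

variable {E F : Type*} [NormedAddCommGroup E] [NormedSpace ℝ E]
  [NormedAddCommGroup F] [NormedSpace ℝ F]

theorem mem_limitingJacobians_iff {f : E → F} {p : E} {L : E →L[ℝ] F} :
    L ∈ limitingJacobians f p ↔
      ∀ ε > 0, ∃ q, DifferentiableAt ℝ f q ∧ dist q p < ε ∧ dist (fderiv ℝ f q) L < ε := by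
  constructor
  · rintro ⟨u, hu, hup, huL⟩ ε hε
    obtain ⟨n, h1, h2⟩ := ((Metric.tendsto_nhds.1 hup ε hε).and
      (Metric.tendsto_nhds.1 huL ε hε)).exists
    exact ⟨u n, hu n, h1, h2⟩
  · intro h
    choose u hu h1 h2 using fun n : ℕ => h (1 / ((n : ℝ) + 1)) Nat.one_div_pos_of_nat
    refine ⟨u, hu, tendsto_iff_dist_tendsto_zero.2 ?_, tendsto_iff_dist_tendsto_zero.2 ?_⟩
    · exact squeeze_zero (fun _ => dist_nonneg) (fun n => (h1 n).le)
        tendsto_one_div_add_atTop_nhds_zero_nat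
    · exact squeeze_zero (fun _ => dist_nonneg) (fun n => (h2 n).le)
        tendsto_one_div_add_atTop_nhds_zero_nat

theorem isClosed_limitingJacobians (f : E → F) (p : E) : IsClosed (limitingJacobians f p) := by
  refine isClosed_of_closure_subset fun L hL => mem_limitingJacobians_iff.2 fun ε hε => ?_
  obtain ⟨M, hM, hLM⟩ := Metric.mem_closure_iff.1 hL (ε / 2) (half_pos hε)
  obtain ⟨q, hq, h1, h2⟩ := mem_limitingJacobians_iff.1 hM (ε / 2) (half_pos hε)
  refine ⟨q, hq, h1.trans (half_lt_self hε), ?_⟩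
  calc dist (fderiv ℝ f q) L ≤ dist (fderiv ℝ f q) M + dist M L := dist_triangle _ _ _
    _ < ε := by rw [dist_comm M L]; linarith

/-- Derivatives depend only on germs; this permits replacing `f` by a global Lipschitz extension. -/
theorem Filter.EventuallyEq.limitingJacobians_subset {f g : E → F} {p : E} (h : f =ᶠ[𝓝 p] g) :
    limitingJacobians f p ⊆ limitingJacobians g p := by
  rintro L ⟨u, hu, hup, huL⟩
  obtain ⟨N, hN⟩ := eventually_atTop.1 (hup.eventually h.eventually_nhds)
  refine ⟨fun n => u (n + N), fun n => ?_, hup.comp (tendsto_add_atTop_nat N), ?_⟩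
  · exact (hu _).congr_of_eventuallyEq (EventuallyEq.symm (hN _ (Nat.le_add_left N n)))
  · refine (huL.comp (tendsto_add_atTop_nat N)).congr fun n => ?_
    exact EventuallyEq.fderiv_eq (hN _ (Nat.le_add_left N n))

variable [FiniteDimensional ℝ E] [FiniteDimensional ℝ F] {f : E → F} {K : ℝ≥0}

theorem LipschitzWith.isCompact_limitingJacobians (hf : LipschitzWith K f) (p : E) :
    IsCompact (limitingJacobians f p) := by
  have := FiniteDimensional.proper ℝ (E →L[ℝ] F)
  refine (isCompact_closedBall (0 : E →L[ℝ] F) K).of_isClosed_subset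
    (isClosed_limitingJacobians f p) ?_
  rintro L ⟨u, -, -, huL⟩
  refine Metric.isClosed_closedBall.mem_of_tendsto huL (Eventually.of_forall fun n => ?_)
  simpa using norm_fderiv_le_of_lipschitz ℝ hf

theorem LipschitzWith.isCompact_clarkeJacobian (hf : LipschitzWith K f) (p : E) :
    IsCompact (clarkeJacobian f p) :=
  (hf.isCompact_limitingJacobians p).convexHull_of_finiteDimensional

/-- Upper semicontinuity: near `p` the derivatives of `f` are close to the generalized
Jacobian at `p`. -/
theorem LipschitzWith.eventually_fderiv_mem_cthickening (hf : LipschitzWith K f) (p : E)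
    {η : ℝ} (hη : 0 < η) :
    ∀ᶠ q in 𝓝 p, DifferentiableAt ℝ f q →
      fderiv ℝ f q ∈ Metric.cthickening η (clarkeJacobian f p) := by
  by_contra hcon
  have hfr : ∃ᶠ q in 𝓝 p, DifferentiableAt ℝ f q ∧
      fderiv ℝ f q ∉ Metric.cthickening η (clarkeJacobian f p) := by
    intro h
    exact hcon (h.mono fun q hq hd => by_contra fun hn => hq ⟨hd, hn⟩)
  obtain ⟨u, hup, hu⟩ := exists_seq_forall_of_frequently hfr
  have := FiniteDimensional.proper ℝ (E →L[ℝ] F)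
  obtain ⟨L, -, φ, hφ, hL⟩ := (isCompact_closedBall (0 : E →L[ℝ] F) K).tendsto_subseq
    (x := fun n => fderiv ℝ f (u n)) fun n => by
      simpa using norm_fderiv_le_of_lipschitz ℝ hf
  have hLm : L ∈ clarkeJacobian f p := subset_convexHull ℝ _
    ⟨u ∘ φ, fun n => (hu _).1, hup.comp hφ.tendsto_atTop, hL⟩
  obtain ⟨n, hn⟩ := (hL.eventually (Metric.ball_mem_nhds L hη)).exists
  exact (hu (φ n)).2 (Metric.closedBall_subset_cthickening hLm η
    (Metric.ball_subset_closedBall hn))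

end Jacobian

/-! ### Smoothing by averages and the mean value inclusion -/

section Approximation

open MeasureTheory

variable {E F : Type*} [NormedAddCommGroup E] [NormedSpace ℝ E] [FiniteDimensional ℝ E]
  [NormedAddCommGroup F] [NormedSpace ℝ F] [FiniteDimensional ℝ F]

/-- A Lipschitz function is uniformly close to differentiable functions whose derivatives are
averages of nearby derivatives of the original function. -/
theorem LipschitzWith.exists_differentiable_approx {f : E → F} {K : ℝ≥0}
    (hf : LipschitzWith K f) {C : Set (E →L[ℝ] F)} (hconv : Convex ℝ C) (hclosed : IsClosed C)
    {p₀ : E} {r : ℝ}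
    (hC : ∀ q ∈ Metric.ball p₀ r, DifferentiableAt ℝ f q → fderiv ℝ f q ∈ C)
    {ε : ℝ} (hε : 0 < ε) :
    ∃ g : E → F, (∀ p, ‖g p - f p‖ ≤ K * ε) ∧
      ∀ p ∈ Metric.ball p₀ (r - ε), ∃ A ∈ C, HasFDerivAt g A p := by
  borelize E F
  have := FiniteDimensional.proper ℝ E
  have := FiniteDimensional.proper ℝ (E →L[ℝ] F)
  have := FiniteDimensional.complete ℝ F
  let μ : Measure E := Measure.addHaar
  let ν : Measure E := ProbabilityTheory.cond μ (Metric.ball 0 ε)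
  have hν : IsProbabilityMeasure ν := ProbabilityTheory.cond_isProbabilityMeasure_of_finite
    (Metric.measure_ball_pos μ 0 hε).ne' measure_ball_lt_top.ne
  have hball : ∀ᵐ t ∂ν, t ∈ Metric.ball (0 : E) ε :=
    ProbabilityTheory.ae_cond_mem Metric.isOpen_ball.measurableSet
  have hdist : ∀ p, ∀ᵐ t ∂ν, ‖f (p + t) - f p‖ ≤ K * ε := fun p => by
    filter_upwards [hball] with t ht
    have h1 := hf.norm_sub_le (p + t) p
    rw [add_sub_cancel_left] at h1
    exact h1.trans (mul_le_mul_of_nonneg_left (mem_ball_zero_iff.1 ht).le K.2)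
  have hcont : ∀ p, Continuous fun t => f (p + t) := fun p =>
    hf.continuous.comp (continuous_const.add continuous_id)
  have hint : ∀ p, Integrable (fun t => f (p + t)) ν := fun p => by
    refine Integrable.of_bound (hcont p).aestronglyMeasurable (K * ε + ‖f p‖) ?_
    filter_upwards [hdist p] with t ht
    have := norm_add_le (f (p + t) - f p) (f p)
    rw [sub_add_cancel] at this
    linarith
  refine ⟨fun p => ∫ t, f (p + t) ∂ν, fun p => ?_, fun p hp => ?_⟩
  · have h1 : (∫ t, f (p + t) ∂ν) - f p = ∫ t, (f (p + t) - f p) ∂ν := by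
      rw [integral_sub (hint p) (integrable_const _)]; simp
    rw [h1]
    simpa using norm_integral_le_of_norm_le_const (hdist p)
  -- Rademacher's theorem, translated by `p`, justifies differentiating under the integral.
  · have hdiff : ∀ᵐ t ∂ν, DifferentiableAt ℝ f (p + t) := by
      have h1 : ∀ᵐ t ∂μ, DifferentiableAt ℝ f (p + t) :=
        (measurePreserving_add_left μ p).quasiMeasurePreserving.ae hf.ae_differentiableAt
      exact ProbabilityTheory.cond_absolutelyContinuous.ae_le h1
    obtain ⟨hI, hD⟩ := hasFDerivAt_integral_of_dominated_loc_of_lip (𝕜 := ℝ) (μ := ν)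
      (F := fun p t => f (p + t)) (F' := fun t => fderiv ℝ f (p + t)) (x₀ := p)
      (bound := fun _ => (K : ℝ)) (s := univ) univ_mem
      (Eventually.of_forall fun q => (hcont q).aestronglyMeasurable) (hint p)
      (((measurable_fderiv ℝ f).comp (measurable_const_add p)).aestronglyMeasurable)
      (Eventually.of_forall fun t => by
        simpa [Function.comp_def] using hf.comp (LipschitzWith.id.add (LipschitzWith.const t)))
      (integrable_const _)
      (hdiff.mono fun t ht => (hasFDerivAt_comp_add_right t).2 ht.hasFDerivAt)
    refine ⟨_, hconv.integral_mem hclosed ?_ hI, hD⟩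
    filter_upwards [hball, hdiff] with t ht hd
    refine hC _ ?_ hd
    rw [Metric.mem_ball, dist_eq_norm] at hp ⊢
    have := norm_add_le (p - p₀) t
    rw [show p - p₀ + t = p + t - p₀ by abel] at this
    linarith [mem_ball_zero_iff.1 ht]

omit [FiniteDimensional ℝ E] [FiniteDimensional ℝ F] in
/-- Mean value inclusion for vector-valued maps with derivatives in a compact convex set. -/
theorem Convex.exists_sub_eq_apply_of_hasFDerivAt_mem {C : Set (E →L[ℝ] F)} (hconv : Convex ℝ C)
    (hcomp : IsCompact C) {s : Set E} (hs : Convex ℝ s) {g : E → F}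
    (hg : ∀ p ∈ s, ∃ A ∈ C, HasFDerivAt g A p) {p q : E} (hp : p ∈ s) (hq : q ∈ s) :
    ∃ A ∈ C, g q - g p = A (q - p) := by
  by_contra hcon
  let ev : (E →L[ℝ] F) →L[ℝ] F := ContinuousLinearMap.apply ℝ F (q - p)
  have hnot : g q - g p ∉ ev '' C := by
    rintro ⟨A, hA, h⟩
    exact hcon ⟨A, hA, h.symm⟩
  -- A functional separating the increment from the compact convex set of values contradicts the
  -- scalar mean value theorem for `l ∘ g`.
  obtain ⟨l, b, hl, hb⟩ := geometric_hahn_banach_closed_point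
    (hconv.linear_image ev.toLinearMap) (hcomp.image ev.continuous).isClosed hnot
  choose! A hA hgA using hg
  obtain ⟨z, hz, hzeq⟩ := domain_mvt (f := fun x => l (g x)) (f' := fun x => l.comp (A x))
    (fun x hx => (l.hasFDerivAt.comp x (hgA x hx)).hasFDerivWithinAt) hs hp hq
  have h1 := hl _ ⟨A z, hA z (hs.segment_subset hp hq hz), rfl⟩
  have h2 : l (g q - g p) = l (A z (q - p)) := by rw [map_sub]; exact hzeq
  rw [h2] at hb
  exact lt_asymm hb h1

end Approximation

/-- A continuous map with injective derivatives attains the value `z` inside a ball on whose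
boundary it is further from `z` than at the centre. -/
theorem exists_mem_ball_eq_of_injective_fderiv {Y : Type*} [NormedAddCommGroup Y]
    [InnerProductSpace ℝ Y] [FiniteDimensional ℝ Y] {g : Y → Y} {y₀ z : Y} {ρ : ℝ} (hρ : 0 < ρ)
    (hcont : ContinuousOn g (Metric.closedBall y₀ ρ))
    (hg : ∀ y ∈ Metric.ball y₀ ρ, ∃ B : Y →L[ℝ] Y, Function.Injective B ∧ HasFDerivAt g B y)
    (hbd : ∀ y ∈ Metric.sphere y₀ ρ, ‖g y₀ - z‖ < ‖g y - z‖) :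
    ∃ y ∈ Metric.ball y₀ ρ, g y = z := by
  have := FiniteDimensional.proper ℝ Y
  obtain ⟨y, hy, hmin⟩ := (isCompact_closedBall y₀ ρ).exists_isMinOn
    (f := fun y => ‖g y - z‖) ⟨y₀, Metric.mem_closedBall_self hρ.le⟩
    (hcont.sub continuousOn_const).norm
  have hyb : y ∈ Metric.ball y₀ ρ := by
    refine lt_of_le_of_ne (Metric.mem_closedBall.1 hy) fun h => ?_
    exact (hbd y h).not_ge (hmin (Metric.mem_closedBall_self hρ.le))
  refine ⟨y, hyb, ?_⟩
  obtain ⟨B, hB, hd⟩ := hg y hyb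
  -- At an interior minimum of the squared distance, `g y - z` is orthogonal to the range of `B`,
  -- which is all of `Y`.
  have hloc : IsLocalMin (fun y => ‖g y - z‖ ^ 2) y := by
    filter_upwards [Metric.isOpen_ball.mem_nhds hyb] with w hw
    exact pow_le_pow_left₀ (norm_nonneg _) (hmin (Metric.ball_subset_closedBall hw)) 2
  have h0 := hloc.hasFDerivAt_eq_zero ((hd.sub_const z).norm_sq)
  obtain ⟨v, hv⟩ := (LinearMap.injective_iff_surjective (f := B.toLinearMap)).1 hB (g y - z)
  have h1 := congrArg (fun T : Y →L[ℝ] ℝ => T v) h0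
  have hv' : B v = g y - z := hv
  have h2 : inner ℝ (g y - z) (B v) = 0 := by simpa [inner_sub_left] using h1
  rw [hv', real_inner_self_eq_norm_sq] at h2
  exact sub_eq_zero.1 (norm_eq_zero.1 (pow_eq_zero_iff two_ne_zero |>.1 h2))

/-! ### Lower bound and solvability in the second variable -/

section Implicit

variable {X Y : Type*} [NormedAddCommGroup X] [NormedSpace ℝ X] [FiniteDimensional ℝ X]
  [NormedAddCommGroup Y] [InnerProductSpace ℝ Y] [FiniteDimensional ℝ Y]
  {f : X × Y → Y} {K : ℝ≥0} {C : Set (X × Y →L[ℝ] Y)} {c r : ℝ} {p₀ : X × Y}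

/-- If the derivatives of `f` lie in a compact convex set of operators that are bounded below on
the second factor, then `f` itself is bounded below in its second variable. -/
theorem LipschitzWith.mul_norm_sub_le_of_fderiv_mem (hf : LipschitzWith K f)
    (hconv : Convex ℝ C) (hcomp : IsCompact C)
    (hc : ∀ A ∈ C, ∀ v : Y, c * ‖v‖ ≤ ‖A (0, v)‖)
    (hC : ∀ q ∈ Metric.ball p₀ r, DifferentiableAt ℝ f q → fderiv ℝ f q ∈ C)
    {x : X} {y₁ y₂ : Y} (h₁ : (x, y₁) ∈ Metric.ball p₀ r) (h₂ : (x, y₂) ∈ Metric.ball p₀ r) :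
    c * ‖y₂ - y₁‖ ≤ ‖f (x, y₂) - f (x, y₁)‖ := by
  have hlim : Tendsto (fun ε : ℝ => ‖f (x, y₂) - f (x, y₁)‖ + 2 * (K * ε)) (𝓝[>] 0)
      (𝓝 ‖f (x, y₂) - f (x, y₁)‖) := by
    have : Continuous fun ε : ℝ => ‖f (x, y₂) - f (x, y₁)‖ + 2 * (K * ε) := by fun_prop
    simpa using (this.tendsto 0).mono_left nhdsWithin_le_nhds
  have hr₁ : 0 < r - dist (x, y₁) p₀ := sub_pos.2 h₁
  have hr₂ : 0 < r - dist (x, y₂) p₀ := sub_pos.2 h₂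
  refine ge_of_tendsto hlim ?_
  filter_upwards [self_mem_nhdsWithin, nhdsWithin_le_nhds (Iio_mem_nhds hr₁),
    nhdsWithin_le_nhds (Iio_mem_nhds hr₂)] with ε hε hε₁ hε₂
  rw [mem_Iio] at hε₁ hε₂
  obtain ⟨g, hgf, hg⟩ := hf.exists_differentiable_approx hconv hcomp.isClosed hC hε
  obtain ⟨A, hA, hAeq⟩ := hconv.exists_sub_eq_apply_of_hasFDerivAt_mem hcomp
    (convex_ball p₀ (r - ε)) hg (p := (x, y₁)) (q := (x, y₂))
    (Metric.mem_ball.2 (by linarith)) (Metric.mem_ball.2 (by linarith))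
  have h3 := hc A hA (y₂ - y₁)
  rw [Prod.mk_sub_mk, sub_self] at hAeq
  rw [← hAeq] at h3
  have h4 : g (x, y₂) - g (x, y₁) = (g (x, y₂) - f (x, y₂)) + (f (x, y₂) - f (x, y₁))
      - (g (x, y₁) - f (x, y₁)) := by abel
  have h5 := _root_.norm_sub_le ((g (x, y₂) - f (x, y₂)) + (f (x, y₂) - f (x, y₁)))
    (g (x, y₁) - f (x, y₁))
  have h6 := norm_add_le (g (x, y₂) - f (x, y₂)) (f (x, y₂) - f (x, y₁))
  rw [← h4] at h5
  linarith [hgf (x, y₁), hgf (x, y₂)]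

/-- Solvability of `f (x, y) = z` in `y`, when `f (x, y₀)` is close enough to `z`. -/
theorem LipschitzWith.exists_eq_of_fderiv_mem (hf : LipschitzWith K f)
    (hconv : Convex ℝ C) (hcomp : IsCompact C) (hc0 : 0 < c)
    (hc : ∀ A ∈ C, ∀ v : Y, c * ‖v‖ ≤ ‖A (0, v)‖)
    (hC : ∀ q ∈ Metric.ball p₀ r, DifferentiableAt ℝ f q → fderiv ℝ f q ∈ C)
    {x : X} {y₀ z : Y} {ρ r' : ℝ} (hρ : 0 < ρ) (hr : r' < r)
    (hball : ∀ y ∈ Metric.closedBall y₀ ρ, (x, y) ∈ Metric.ball p₀ r')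
    (hz : 2 * ‖f (x, y₀) - z‖ < c * ρ) :
    ∃ y ∈ Metric.closedBall y₀ ρ, f (x, y) = z := by
  have := FiniteDimensional.proper ℝ Y
  have hy₀ : y₀ ∈ Metric.closedBall y₀ ρ := Metric.mem_closedBall_self hρ.le
  have hfx : Continuous fun y => ‖f (x, y) - z‖ :=
    ((hf.continuous.comp (Continuous.prodMk_right x)).sub continuous_const).norm
  -- The minimizer is fixed before `ε`; its residual is at most `K * ε` for all small `ε`, hence
  -- zero.
  obtain ⟨y, hy, hmin⟩ := (isCompact_closedBall y₀ ρ).exists_isMinOn ⟨y₀, hy₀⟩ hfx.continuousOn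
  refine ⟨y, hy, sub_eq_zero.1 (norm_le_zero_iff.1 ?_)⟩
  have hlim : Tendsto (fun ε : ℝ => K * ε) (𝓝[>] 0) (𝓝 0) := by
    have : Continuous fun ε : ℝ => K * ε := by fun_prop
    simpa using (this.tendsto 0).mono_left nhdsWithin_le_nhds
  refine ge_of_tendsto hlim ?_
  filter_upwards [self_mem_nhdsWithin, nhdsWithin_le_nhds (Iio_mem_nhds (sub_pos.2 hr)),
    -- This makes `2 * ‖g (x, y₀) - z‖ < c * ρ`, so `g (x, ·)` is further from `z` on the sphere
    -- than at the centre.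
    hlim.eventually (Iio_mem_nhds (show 0 < (c * ρ - 2 * ‖f (x, y₀) - z‖) / 2 by linarith))]
    with ε hε hεr hεz
  rw [mem_Iio] at hεr
  obtain ⟨g, hgf, hg⟩ := hf.exists_differentiable_approx hconv hcomp.isClosed hC hε
  have hmem : ∀ w ∈ Metric.closedBall y₀ ρ, (x, w) ∈ Metric.ball p₀ (r - ε) := fun w hw =>
    Metric.ball_subset_ball (by linarith) (hball w hw)
  have hgx : ∀ w ∈ Metric.closedBall y₀ ρ, ∃ B : Y →L[ℝ] Y, Function.Injective B ∧
      HasFDerivAt (fun w => g (x, w)) B w := fun w hw => by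
    obtain ⟨A, hA, hd⟩ := hg _ (hmem w hw)
    refine ⟨A.comp (ContinuousLinearMap.inr ℝ X Y), ?_, hd.comp w (hasFDerivAt_prodMk_right x w)⟩
    refine (injective_iff_map_eq_zero _).2 fun v hv => ?_
    have h1 := hc A hA v
    rw [show A (0, v) = 0 from hv, norm_zero] at h1
    exact norm_le_zero_iff.1 (nonpos_of_mul_nonpos_right h1 hc0)
  obtain ⟨w, hw, hgw⟩ := exists_mem_ball_eq_of_injective_fderiv (g := fun w => g (x, w)) (z := z)
    hρ (fun w hw => (hgx w hw).choose_spec.2.continuousAt.continuousWithinAt)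
    (fun w hw => hgx w (Metric.ball_subset_closedBall hw)) (fun w hw => by
      obtain ⟨A, hA, hAeq⟩ := hconv.exists_sub_eq_apply_of_hasFDerivAt_mem hcomp
        (convex_ball p₀ (r - ε)) hg (hmem y₀ hy₀) (hmem w (Metric.sphere_subset_closedBall hw))
      have h3 := hc A hA (w - y₀)
      rw [Prod.mk_sub_mk, sub_self] at hAeq
      rw [← hAeq, mem_sphere_iff_norm.1 hw] at h3
      have h4 := _root_.norm_sub_le (g (x, w) - z) (g (x, y₀) - z)
      rw [sub_sub_sub_cancel_right] at h4
      have h5 := norm_add_le (g (x, y₀) - f (x, y₀)) (f (x, y₀) - z)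
      rw [sub_add_sub_cancel] at h5
      linarith [hgf (x, y₀)])
  refine (hmin (Metric.ball_subset_closedBall hw)).trans ?_
  have h6 : f (x, w) - z = -(g (x, w) - f (x, w)) := by
    rw [show g (x, w) = z from hgw]; abel
  change ‖f (x, w) - z‖ ≤ _
  rw [h6, norm_neg]
  exact hgf _

omit [FiniteDimensional ℝ X] in
/-- A compact set of operators injective on the second factor has a convex compact neighbourhood
of operators uniformly bounded below there. -/
theorem exists_pos_forall_mem_cthickening_le (hcomp : IsCompact C)
    (hinj : ∀ A ∈ C, ∀ v : Y, A (0, v) = 0 → v = 0) :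
    ∃ c > 0, ∀ A ∈ Metric.cthickening c C, ∀ v : Y, c * ‖v‖ ≤ ‖A (0, v)‖ := by
  have := FiniteDimensional.proper ℝ Y
  obtain ⟨c, hc, hle⟩ := (hcomp.prod (isCompact_sphere (0 : Y) 1)).exists_forall_le'
    (f := fun q : (X × Y →L[ℝ] Y) × Y => ‖q.1 (0, q.2)‖) (a := 0) (by fun_prop)
    (fun q hq => norm_pos_iff.2 fun h0 => by
      have := hinj q.1 hq.1 q.2 h0
      have h1 := mem_sphere_zero_iff_norm.1 hq.2
      simp [this] at h1)
  have hlow : ∀ A ∈ C, ∀ v : Y, c * ‖v‖ ≤ ‖A (0, v)‖ := fun A hA v => by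
    rcases eq_or_ne v 0 with rfl | hv
    · simp
    have hv' : 0 < ‖v‖ := norm_pos_iff.2 hv
    have h1 : c ≤ ‖A (0, ‖v‖⁻¹ • v)‖ := hle (A, ‖v‖⁻¹ • v)
      ⟨hA, mem_sphere_zero_iff_norm.2 (norm_smul_inv_norm (𝕜 := ℝ) hv)⟩
    have h2 : ((0 : X), ‖v‖⁻¹ • v) = ‖v‖⁻¹ • ((0 : X), v) := by simp
    rw [h2, map_smul, norm_smul, norm_inv, norm_norm, inv_mul_eq_div, le_div_iff₀ hv'] at h1
    exact h1
  -- Moving by at most `c / 2` in operator norm costs at most half of the lower bound `c`.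
  refine ⟨c / 2, half_pos hc, fun A hA v => ?_⟩
  rw [hcomp.cthickening_eq_biUnion_closedBall (half_pos hc).le] at hA
  obtain ⟨B, hB, hAB⟩ := mem_iUnion₂.1 hA
  have h1 := (B - A).le_opNorm (0, v)
  rw [sub_apply, Prod.norm_mk, norm_zero, max_eq_right (norm_nonneg v),
    ← dist_eq_norm B A, dist_comm] at h1
  have h2 := mul_le_mul_of_nonneg_right (Metric.mem_closedBall.1 hAB) (norm_nonneg v)
  have h3 := norm_sub_norm_le (B (0, v)) (A (0, v))
  linarith [hlow B hB v]

end Implicit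

/-! ### The implicit function -/

theorem theorem2p2 (m k : ℕ)
    (f : EuclideanSpace ℝ (Fin m) × EuclideanSpace ℝ (Fin k) → EuclideanSpace ℝ (Fin k))
    (x₀ : EuclideanSpace ℝ (Fin m)) (y₀ z₀ : EuclideanSpace ℝ (Fin k))
    (Ω : Set (EuclideanSpace ℝ (Fin m) × EuclideanSpace ℝ (Fin k)))
    (hΩ : Ω ∈ 𝓝 (x₀, y₀))
    (hf : ∃ K : ℝ≥0, LipschitzOnWith K f Ω)
    (hz : f (x₀, y₀) = z₀)
    (hker : ∀ ℓ ∈ clarkeJacobian f (x₀, y₀),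
      LinearMap.ker (ℓ : EuclideanSpace ℝ (Fin m) × EuclideanSpace ℝ (Fin k) →ₗ[ℝ]
          EuclideanSpace ℝ (Fin k)) ⊓
        (Submodule.prod ⊥ ⊤ :
          Submodule ℝ (EuclideanSpace ℝ (Fin m) × EuclideanSpace ℝ (Fin k))) = ⊥) :
    ∃ (U : Set (EuclideanSpace ℝ (Fin m))) (V : Set (EuclideanSpace ℝ (Fin k)))
      (hx : x₀ ∈ U) (hy : y₀ ∈ V),
      IsOpen U ∧ IsOpen V ∧ U ×ˢ V ⊆ Ω ∧
      ∃! g : U → V,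
        (∃ K : ℝ≥0, LipschitzWith K g) ∧ g ⟨x₀, hx⟩ = ⟨y₀, hy⟩ ∧
        f ⁻¹' {z₀} ∩ U ×ˢ V =
          range (fun x : U =>
            ((x : EuclideanSpace ℝ (Fin m)), (g x : EuclideanSpace ℝ (Fin k)))) := by
  obtain ⟨K₀, hK₀⟩ := hf
  obtain ⟨F, hF, hfF⟩ := hK₀.extend_finite_dimension
  generalize lipschitzExtensionConstant (EuclideanSpace ℝ (Fin k)) * K₀ = K at hF
  have hFf : F =ᶠ[𝓝 (x₀, y₀)] f := mem_of_superset hΩ fun q hq => (hfF hq).symm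
  have hJ : clarkeJacobian F (x₀, y₀) ⊆ clarkeJacobian f (x₀, y₀) :=
    convexHull_mono hFf.limitingJacobians_subset
  have hJcomp := hF.isCompact_clarkeJacobian (x₀, y₀)
  obtain ⟨c, hc0, hc⟩ := exists_pos_forall_mem_cthickening_le hJcomp fun A hA v hv => by
    have h1 : ((0, v) : EuclideanSpace ℝ (Fin m) × EuclideanSpace ℝ (Fin k)) ∈
        (⊥ : Submodule ℝ (EuclideanSpace ℝ (Fin m) × EuclideanSpace ℝ (Fin k))) := by
      rw [← hker A (hJ hA)]
      exact ⟨hv, by simp⟩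
    simpa using h1
  have hCcomp : IsCompact (Metric.cthickening c (clarkeJacobian F (x₀, y₀))) := by
    have := FiniteDimensional.proper ℝ
      (EuclideanSpace ℝ (Fin m) × EuclideanSpace ℝ (Fin k) →L[ℝ] EuclideanSpace ℝ (Fin k))
    exact hJcomp.cthickening
  have hCconv : Convex ℝ (Metric.cthickening c (clarkeJacobian F (x₀, y₀))) :=
    (convex_convexHull ℝ _).cthickening c
  obtain ⟨r, hr, hball⟩ := Metric.eventually_nhds_iff_ball.1
    ((hF.eventually_fderiv_mem_cthickening (x₀, y₀) hc0).and hΩ)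
  have hC := fun q hq => (hball q hq).1
  have hΩr := fun q hq => (hball q hq).2
  -- The margin between `r / 2` and `r` leaves room for averaging.
  obtain ⟨ρ, hρ, hρr⟩ : ∃ ρ > 0, ρ < r / 2 := exists_between (half_pos hr)
  obtain ⟨σ, hσ, hσρ, hKσ⟩ : ∃ σ > 0, σ ≤ ρ ∧ 2 * (K * σ) < c * ρ := by
    have hlim : Tendsto (fun σ : ℝ => 2 * (K * σ)) (𝓝[>] 0) (𝓝 0) := by
      have : Continuous fun σ : ℝ => 2 * (K * σ) := by fun_prop
      simpa using (this.tendsto 0).mono_left nhdsWithin_le_nhds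
    obtain ⟨σ, h1, h2, h3⟩ := (eventually_mem_nhdsWithin.and
      ((eventually_nhdsWithin_of_eventually_nhds (Iic_mem_nhds hρ)).and
      (hlim.eventually (Iio_mem_nhds (mul_pos hc0 hρ))))).exists
    exact ⟨σ, h1, h2, h3⟩
  have hsub : ∀ x ∈ Metric.ball x₀ σ, ∀ y ∈ Metric.closedBall y₀ ρ,
      (x, y) ∈ Metric.ball (x₀, y₀) (r / 2) := fun x hx y hy =>
    max_lt ((Metric.mem_ball.1 hx).trans_le hσρ |>.trans hρr)
      ((Metric.mem_closedBall.1 hy).trans_lt hρr)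
  have hsub' : ∀ x ∈ Metric.ball x₀ σ, ∀ y ∈ Metric.closedBall y₀ ρ,
      (x, y) ∈ Metric.ball (x₀, y₀) r := fun x hx y hy =>
    Metric.ball_subset_ball (by linarith) (hsub x hx y hy)
  have hlow : ∀ x ∈ Metric.ball x₀ σ, ∀ y₁ ∈ Metric.closedBall y₀ ρ,
      ∀ y₂ ∈ Metric.closedBall y₀ ρ, c * ‖y₂ - y₁‖ ≤ ‖F (x, y₂) - F (x, y₁)‖ :=
    fun x hx y₁ h₁ y₂ h₂ => hF.mul_norm_sub_le_of_fderiv_mem hCconv hCcomp hc hC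
      (hsub' x hx y₁ h₁) (hsub' x hx y₂ h₂)
  have hlip : ∀ x x' y, ‖F (x, y) - F (x', y)‖ ≤ K * ‖x - x'‖ := fun x x' y => by
    simpa [Prod.norm_mk] using hF.norm_sub_le (x, y) (x', y)
  have hy₀ : y₀ ∈ Metric.closedBall y₀ ρ := Metric.mem_closedBall_self hρ.le
  have hF₀ : F (x₀, y₀) = z₀ := by rw [← hz]; exact hFf.eq_of_nhds
  have hsol : ∀ x : Metric.ball x₀ σ, ∃ y : Metric.ball y₀ ρ, F (x, y) = z₀ := by
    rintro ⟨x, hx⟩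
    have h1 : ‖F (x, y₀) - z₀‖ ≤ K * σ := by
      rw [← hF₀]
      exact (hlip x x₀ y₀).trans
        (mul_le_mul_of_nonneg_left (mem_ball_iff_norm.1 hx).le K.2)
    obtain ⟨y, hy, hyz⟩ := hF.exists_eq_of_fderiv_mem hCconv hCcomp hc0 hc hC hρ
      (half_lt_self hr) (hsub x hx) (z := z₀) (by linarith)
    refine ⟨⟨y, ?_⟩, hyz⟩
    have h2 := hlow x hx y₀ hy₀ y hy
    rw [hyz, norm_sub_rev z₀] at h2
    rw [mem_ball_iff_norm]
    exact lt_of_mul_lt_mul_left (by linarith [norm_nonneg (F (x, y₀) - z₀)]) hc0.le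
  choose g hg using hsol
  have hfF' : ∀ x ∈ Metric.ball x₀ σ, ∀ y ∈ Metric.ball y₀ ρ, f (x, y) = F (x, y) :=
    fun x hx y hy => hfF (hΩr _ (hsub' x hx y (Metric.ball_subset_closedBall hy)))
  have huniq : ∀ x : Metric.ball x₀ σ, ∀ y : Metric.ball y₀ ρ, F (x, y) = z₀ → y = g x :=
    fun x y hxy => by
      have h1 := hlow x x.2 _ (Metric.ball_subset_closedBall (g x).2) _
        (Metric.ball_subset_closedBall y.2)
      rw [hxy, hg x, sub_self, norm_zero] at h1
      exact Subtype.ext (sub_eq_zero.1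
        (norm_le_zero_iff.1 (nonpos_of_mul_nonpos_right h1 hc0)))
  refine ⟨Metric.ball x₀ σ, Metric.ball y₀ ρ, Metric.mem_ball_self hσ, Metric.mem_ball_self hρ,
    Metric.isOpen_ball, Metric.isOpen_ball, ?_, g, ⟨⟨K / c.toNNReal, ?_⟩, ?_, ?_⟩, ?_⟩
  · rintro ⟨x, y⟩ ⟨hx, hy⟩
    exact hΩr _ (hsub' x hx y (Metric.ball_subset_closedBall hy))
  · refine LipschitzWith.of_dist_le_mul fun x x' => ?_
    -- Since `F (x', g x') = F (x, g x)`, the lower bound at `x'` compares `g x - g x'` with `F (x',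
    -- g x) - F (x, g x)`.
    have h1 := hlow x' x'.2 _ (Metric.ball_subset_closedBall (g x').2) _
      (Metric.ball_subset_closedBall (g x).2)
    rw [hg x', ← hg x] at h1
    have h2 := h1.trans (hlip x' x (g x))
    rw [NNReal.coe_div, Real.coe_toNNReal c hc0.le, div_mul_eq_mul_div, le_div_iff₀ hc0,
      mul_comm, Subtype.dist_eq, Subtype.dist_eq, dist_eq_norm, dist_comm, dist_eq_norm]
    exact h2
  · exact (huniq _ ⟨y₀, Metric.mem_ball_self hρ⟩ hF₀).symm
  · ext ⟨x, y⟩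
    constructor
    · rintro ⟨hxy, hx, hy⟩
      refine ⟨⟨x, hx⟩, ?_⟩
      have h1 := huniq ⟨x, hx⟩ ⟨y, hy⟩ (by rw [← hfF' x hx y hy]; exact hxy)
      simp only [← h1]
    · rintro ⟨x', h⟩
      obtain ⟨rfl, rfl⟩ := Prod.mk.inj h
      exact ⟨(hfF' x' x'.2 _ (g x').2).trans (hg x'), x'.2, (g x').2⟩
  · rintro g' ⟨-, -, hg'⟩
    funext x
    refine huniq x (g' x) ?_
    have h1 : ((x : EuclideanSpace ℝ (Fin m)), (g' x : EuclideanSpace ℝ (Fin k))) ∈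
        f ⁻¹' {z₀} ∩ Metric.ball x₀ σ ×ˢ Metric.ball y₀ ρ := by
      rw [hg']; exact ⟨x, rfl⟩
    rw [← hfF' x x.2 _ (g' x).2]
    exact h1.1
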